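/- **The model.** Let $m_1,m_2\ge 1$ be integers, let $V=V_1\sqcup V_2\sqcup V_3$ with $V_1=\{u_1,\dots,u_{m_1}\}$, $V_2=\{v_1,\dots,v_{m_2}\}$, $V_3=\{v_1^{-1},\dots,v_{m_2}^{-1}\}$, let $*:V_1\to V_1$, $u\mapsto u^{-1}$, be a fixed-point free involution, let $\pi: V_1\sqcup V_2\to(0,\infty)$ be a vector of weights, and let $0\le p<1/2$. The random graph $\Delta(m_1,m_2,\pi,p,*)$ has vertex set $V$; its edges (at most one for each unordered pair) are added independently, with the following probabilities, which are assumed to be at most $1$: $$\begin{aligned} \{u_i,u_j\}&:\ (\pi(u_i)\pi(u_j^{-1})+\pi(u_i^{-1})\pi(u_j))\,p, & \{u_i,v_j\}&:\ \pi(u_i^{-1})\pi(v_j)\,p,\\ \{u_i,v_j^{-1}\}&:\ \pi(u_i)\pi(v_j)\,p, & \{v_i,v_j^{-1}\}&:\ \pi(v_i)\pi(v_j)\,p, \end{aligned}$$ and there are no edges inside $V_2$ or inside $V_3$. Loops at vertices of $V_1$ (the case $i=j$ of the first kind) may consistently be either excluded or included; the lemma holds for both conventions. Put $\pi_{\max}=\max\pi$.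 For a graph $\Sigma$ with adjacency matrix $A$ and diagonal degree matrix $D$ (the row sums of $A$), let $\lambda_0(\Sigma)\le\lambda_1(\Sigma)\le\cdots$ be the eigenvalues, with multiplicity, of the normalised Laplacian $I-D^{-1/2}AD^{-1/2}$ (the diagonal entry of $D^{-1/2}$ at a vertex of degree $0$ is read as $0$). **Lemma.** Let $\pi_{\min}>0$ be a constant. Consider a sequence of parameters $(m_1,m_2,\pi,p,*)$ as above along which $m_1+2m_2\to\infty$, with $\pi\ge\pi_{\min}$ throughout, and suppose that $$(m_1+2m_2)\,p=\Omega\big(\pi_{\max}^{2}\log^{6}(m_1+2m_2)\big),$$ where $f=\Omega(g)$ means $g=o(f)$. Let $\Sigma\sim\Delta(m_1,m_2,\pi,p,*)$. Then there is a function $\varepsilon:\mathbb N\to\mathbb R$ with $\varepsilon(n)\to0$ as $n\to\infty$ such that $$\lambda_1(\Sigma)\ \ge\ 1-\varepsilon(m_1+2m_2)$$ with probability tending to $1$ as $m_1+2m_2\to\infty$. -/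

import Mathlib

open Filter Topology MeasureTheory Asymptotics

noncomputable section

namespace WeightedRandomGraph

/-! ### Normalised Laplacian of an undirected graph, loops allowed, at most one edge per pair -/

section Spectral

variable {V : Type*} [Fintype V] [DecidableEq V]

/-- The adjacency matrix of the graph on `V` whose edges are the unordered pairs `e`
(possibly diagonal, i.e. loops) with `G e = true`. -/
def adjMatrix (G : Sym2 V → Bool) : Matrix V V ℝ :=
  Matrix.of fun x y => if G s(x, y) then 1 else 0

/-- The degree of a vertex, i.e. the row sum of the adjacency matrix. -/
def degree (G : Sym2 V → Bool) (x : V) : ℝ := ∑ y, adjMatrix G x y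

/-- The diagonal matrix `D ^ (-1/2)` (with entry `0` at isolated vertices). -/
def invSqrtDegMatrix (G : Sym2 V → Bool) : Matrix V V ℝ :=
  Matrix.diagonal fun x => (Real.sqrt (degree G x))⁻¹

/-- The normalised Laplacian `L = I - D ^ (-1/2) A D ^ (-1/2)`. -/
def normalizedLaplacian (G : Sym2 V → Bool) : Matrix V V ℝ :=
  1 - invSqrtDegMatrix G * adjMatrix G * invSqrtDegMatrix G

theorem normalizedLaplacian_isHermitian (G : Sym2 V → Bool) :
    (normalizedLaplacian G).IsHermitian := by
  have hA : (adjMatrix G).transpose = adjMatrix G := by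
    ext x y
    simp [adjMatrix, Sym2.eq_swap]
  unfold normalizedLaplacian Matrix.IsHermitian
  simp [Matrix.conjTranspose_eq_transpose_of_trivial, Matrix.transpose_mul, hA,
    invSqrtDegMatrix, Matrix.mul_assoc]

/-- `lambda G i` is the `i`-th eigenvalue `λᵢ` of the normalised Laplacian, where
`λ₀ ≤ λ₁ ≤ ⋯ ≤ λ_{|V| - 1}` are its eigenvalues listed in increasing order with multiplicity
(Mathlib's `eigenvalues₀` lists them in decreasing order); it is `0` for `i ≥ |V|`. -/
def lambda (G : Sym2 V → Bool) (i : ℕ) : ℝ :=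
  if h : i < Fintype.card V then
    (normalizedLaplacian_isHermitian G).eigenvalues₀ (Fin.rev ⟨i, h⟩)
  else 0

end Spectral

/-! ### The random graph `Δ(m₁, m₂, π, p, *)` -/

/-- The vertex set `V₁ ⊔ V₂ ⊔ V₃` with `|V₁| = m₁` and `|V₂| = |V₃| = m₂`:
`Sum.inl i` is `uᵢ`, `Sum.inr (Sum.inl j)` is `vⱼ`, and `Sum.inr (Sum.inr j)` is `vⱼ⁻¹`. -/
abbrev Vertex (m₁ m₂ : ℕ) : Type := Fin m₁ ⊕ (Fin m₂ ⊕ Fin m₂)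

variable {m₁ m₂ : ℕ}

/-- The edge probabilities divided by `p`. Here `star` is the involution `uᵢ ↦ uᵢ⁻¹` of `V₁`, and
`w` is the weight vector, with entries `w (Sum.inl i) = π(uᵢ)` and `w (Sum.inr j) = π(vⱼ)`. -/
def edgeWeight (w : Fin m₁ ⊕ Fin m₂ → ℝ) (star : Fin m₁ → Fin m₁) :
    Vertex m₁ m₂ → Vertex m₁ m₂ → ℝ
  | Sum.inl i, Sum.inl j =>
      w (Sum.inl i) * w (Sum.inl (star j)) + w (Sum.inl (star i)) * w (Sum.inl j)
  | Sum.inl i, Sum.inr (Sum.inl j) => w (Sum.inl (star i)) * w (Sum.inr j)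
  | Sum.inr (Sum.inl j), Sum.inl i => w (Sum.inl (star i)) * w (Sum.inr j)
  | Sum.inl i, Sum.inr (Sum.inr j) => w (Sum.inl i) * w (Sum.inr j)
  | Sum.inr (Sum.inr j), Sum.inl i => w (Sum.inl i) * w (Sum.inr j)
  | Sum.inr (Sum.inl i), Sum.inr (Sum.inr j) => w (Sum.inr i) * w (Sum.inr j)
  | Sum.inr (Sum.inr j), Sum.inr (Sum.inl i) => w (Sum.inr i) * w (Sum.inr j)
  | Sum.inr (Sum.inl _), Sum.inr (Sum.inl _) => 0
  | Sum.inr (Sum.inr _), Sum.inr (Sum.inr _) => 0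

theorem edgeWeight_comm (w : Fin m₁ ⊕ Fin m₂ → ℝ) (star : Fin m₁ → Fin m₁)
    (x y : Vertex m₁ m₂) : edgeWeight w star x y = edgeWeight w star y x := by
  rcases x with i | i | i <;> rcases y with j | j | j <;> simp only [edgeWeight] <;> ring

/-- The probability with which the unordered pair `{x, y}` is an edge. The parameter `loops` says
whether the pairs `{x, x}` are included among the possible edges or not. -/
def edgeProb (loops : Bool) (w : Fin m₁ ⊕ Fin m₂ → ℝ) (p : ℝ) (star : Fin m₁ → Fin m₁) :
    Sym2 (Vertex m₁ m₂) → ℝ :=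
  Sym2.lift ⟨fun x y => if x = y ∧ loops = false then 0 else edgeWeight w star x y * p, by
    intro x y
    simp only [edgeWeight_comm w star x y, eq_comm (a := x) (b := y)]⟩

/-- The law of `Δ(m₁, m₂, π, p, *)`: every unordered pair `e` is an edge with probability
`edgeProb e`, independently of the other pairs. (The projection to `[0, 1]` is the identity
whenever the prescribed numbers are probabilities.) -/
def law (loops : Bool) (w : Fin m₁ ⊕ Fin m₂ → ℝ) (p : ℝ) (star : Fin m₁ → Fin m₁) :
    Measure (Sym2 (Vertex m₁ m₂) → Bool) :=
  Measure.pi fun e => ProbabilityTheory.bernoulliMeasure true false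
    (Set.projIcc (0 : ℝ) 1 zero_le_one (edgeProb loops w p star e))

/-- The maximal weight `π_max`. -/
def weightMax (w : Fin m₁ ⊕ Fin m₂ → ℝ) : ℝ := ⨆ a, w a

end WeightedRandomGraph

end

/-! Give each vertex its own weight `a` and the weight `b` of its inverse, with `0` where undefined.
Off the diagonal, the edge probabilities are `p` times the rank-two form `a x * b y + b x * a y`. On
vectors orthogonal to `a + b` this form equals `-2 (∑ a y)²`, so the expected adjacency matrix is
nonpositive there; excluding loops only lowers it. By min-max, a gap therefore needs just an upper
bound for the fluctuation `A - 𝔼 A` and lower bounds for the degrees.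

The fluctuation, normalised by `d = p S (a + b)` with `S` the total weight, is bounded by the trace
method. In the expectation of a trace power, walks using an edge exactly once vanish, and every
other edge costs a factor `1/N`, where `N` is the number of vertices. A walk visits at most one
vertex more than it uses edges, so the `n`-th moment is at most `N (n+1)! ρ^n`, where `ρ` bounds the
entries and `ρ²/N` their variances. Density gives `ρ = (log N)⁻³`. Taking `n ≈ 2 log N`, the
factorial costs a factor of order `log N` per step, and the fluctuation is below `1 / log N` with
high probability. The degrees exceed `d / 4` by a Chernoff bound. -/

namespace WeightedRandomGraph

/-! ### Eigenvalues, quadratic forms and traces -/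

section RayleighQuotient

open Matrix

variable {V : Type*} [Fintype V] [DecidableEq V] {M : Matrix V V ℝ}

theorem dotProduct_eigenvectorUnitary_mulVec (hM : M.IsHermitian) (c : V → ℝ) :
    ((hM.eigenvectorUnitary : Matrix V V ℝ) *ᵥ c) ⬝ᵥ
      ((hM.eigenvectorUnitary : Matrix V V ℝ) *ᵥ c) = ∑ i, c i ^ 2 := by
  have h : (hM.eigenvectorUnitary : Matrix V V ℝ)ᵀ * (hM.eigenvectorUnitary : Matrix V V ℝ) = 1 := by
    simpa [star_eq_conjTranspose, conjTranspose_eq_transpose_of_trivial] using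
      Unitary.coe_star_mul_self hM.eigenvectorUnitary
  rw [dotProduct_mulVec, ← mulVec_transpose, mulVec_mulVec, h, one_mulVec]
  simp [dotProduct, sq]

theorem dotProduct_mulVec_eigenvectorUnitary_mulVec (hM : M.IsHermitian) (c : V → ℝ) :
    ((hM.eigenvectorUnitary : Matrix V V ℝ) *ᵥ c) ⬝ᵥ
      (M *ᵥ ((hM.eigenvectorUnitary : Matrix V V ℝ) *ᵥ c)) = ∑ i, hM.eigenvalues i * c i ^ 2 := by
  have h : (hM.eigenvectorUnitary : Matrix V V ℝ)ᵀ * (hM.eigenvectorUnitary : Matrix V V ℝ) = 1 := by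
    simpa [star_eq_conjTranspose, conjTranspose_eq_transpose_of_trivial] using
      Unitary.coe_star_mul_self hM.eigenvectorUnitary
  have hMU : M * (hM.eigenvectorUnitary : Matrix V V ℝ) =
      (hM.eigenvectorUnitary : Matrix V V ℝ) * diagonal hM.eigenvalues := by
    ext x i
    have := congrFun (hM.mulVec_eigenvectorBasis i) x
    rw [mul_diagonal, mul_comm]
    simpa [mulVec, dotProduct, mul_apply] using this
  rw [mulVec_mulVec, hMU, ← mulVec_mulVec, dotProduct_mulVec, ← mulVec_transpose, mulVec_mulVec, h,
    one_mulVec]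
  simp only [dotProduct, mulVec_diagonal]
  exact Finset.sum_congr rfl fun i _ => by ring

theorem exists_eigenvectorUnitary_mulVec_eq (hM : M.IsHermitian) (y : V → ℝ) :
    ∃ c : V → ℝ, (hM.eigenvectorUnitary : Matrix V V ℝ) *ᵥ c = y :=
  ⟨star (hM.eigenvectorUnitary : Matrix V V ℝ) *ᵥ y, by
    rw [mulVec_mulVec, Unitary.mul_star_self_of_mem hM.eigenvectorUnitary.2, one_mulVec]⟩

theorem trace_pow_eq_sum_eigenvalues_pow (hM : M.IsHermitian) (n : ℕ) :
    (M ^ n).trace = ∑ i, hM.eigenvalues i ^ n := by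
  conv_lhs => rw [hM.spectral_theorem, ← map_pow]
  rw [Unitary.conjStarAlgAut_apply, trace_mul_cycle, Unitary.coe_star_mul_self, one_mul,
    diagonal_pow, trace_diagonal]
  simp

/-- The quadratic form of a symmetric matrix is controlled by the trace of an even power. -/
theorem dotProduct_mulVec_le_of_trace_pow_le (hM : M.IsHermitian) {n : ℕ} (hn : Even n)
    (hn0 : n ≠ 0) {δ : ℝ} (hδ : 0 ≤ δ) (h : (M ^ n).trace ≤ δ ^ n) (y : V → ℝ) :
    y ⬝ᵥ (M *ᵥ y) ≤ δ * (y ⬝ᵥ y) := by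
  obtain ⟨c, rfl⟩ := exists_eigenvectorUnitary_mulVec_eq hM y
  rw [dotProduct_mulVec_eigenvectorUnitary_mulVec, dotProduct_eigenvectorUnitary_mulVec,
    Finset.mul_sum]
  refine Finset.sum_le_sum fun i _ => mul_le_mul_of_nonneg_right ?_ (sq_nonneg _)
  rw [trace_pow_eq_sum_eigenvalues_pow hM] at h
  -- Even powers are nonnegative, so one eigenvalue's power is at most the whole trace.
  have hi : |hM.eigenvalues i| ^ n ≤ δ ^ n := by
    rw [hn.pow_abs]
    exact (Finset.single_le_sum (f := fun i => hM.eigenvalues i ^ n)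
      (fun j _ => hn.pow_nonneg _) (Finset.mem_univ i)).trans h
  exact (le_abs_self _).trans ((pow_le_pow_iff_left₀ (abs_nonneg _) hδ hn0).1 hi)

/-- A lower bound on the quadratic form on a hyperplane bounds all but the smallest eigenvalue. -/
theorem le_eigenvalues₀_of_forall_dotProduct_eq_zero (hM : M.IsHermitian) (z : V → ℝ) {c : ℝ}
    (h : ∀ x : V → ℝ, z ⬝ᵥ x = 0 → c * (x ⬝ᵥ x) ≤ x ⬝ᵥ (M *ᵥ x))
    (k l : Fin (Fintype.card V)) (hkl : k < l) : c ≤ hM.eigenvalues₀ k := by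
  set e := Fintype.equivOfCardEq (α := Fin (Fintype.card V)) (β := V) (Fintype.card_fin _) with he
  have heig : ∀ j, hM.eigenvalues (e j) = hM.eigenvalues₀ j := fun j => by
    simp [Matrix.IsHermitian.eigenvalues, he]
  have hne : e k ≠ e l := fun hh => hkl.ne (e.injective hh)
  set U := (hM.eigenvectorUnitary : Matrix V V ℝ) with hU
  set q := z ᵥ* U with hq
  -- The plane spanned by the eigenvectors `k` and `l` meets the hyperplane `z ⬝ᵥ x = 0` in a
  -- nonzero vector; its Rayleigh quotient is at most the larger eigenvalue, the `k`-th.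
  obtain ⟨s, t, hst, hpos⟩ : ∃ s t : ℝ, q (e k) * s + q (e l) * t = 0 ∧ 0 < s ^ 2 + t ^ 2 := by
    by_cases h0 : q (e k) = 0
    · exact ⟨1, 0, by simp [h0], by norm_num⟩
    · exact ⟨-q (e l), q (e k), by ring, by positivity⟩
  set v : V → ℝ := fun i => if i = e k then s else if i = e l then t else 0 with hv
  have hsum : ∀ f : V → ℝ, (∀ i, i ≠ e k → i ≠ e l → f i = 0) → ∑ i, f i = f (e k) + f (e l) := by
    intro f hf
    rw [← Finset.sum_pair hne]
    refine (Finset.sum_subset (Finset.subset_univ _) fun i _ hi => ?_).symm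
    simp only [Finset.mem_insert, Finset.mem_singleton, not_or] at hi
    exact hf i hi.1 hi.2
  have hvk : v (e k) = s := by simp [hv]
  have hvl : v (e l) = t := by simp [hv, hne.symm]
  have hv0 : ∀ i, i ≠ e k → i ≠ e l → v i = 0 := fun i h1 h2 => by simp [hv, h1, h2]
  have hz : z ⬝ᵥ (U *ᵥ v) = 0 := by
    rw [dotProduct_mulVec, ← hq, dotProduct, hsum _ fun i h1 h2 => by rw [hv0 i h1 h2, mul_zero],
      hvk, hvl, hst]
  have h1 := h _ hz
  rw [dotProduct_mulVec_eigenvectorUnitary_mulVec, dotProduct_eigenvectorUnitary_mulVec,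
    hsum _ fun i h1 h2 => by rw [hv0 i h1 h2]; simp,
    hsum _ fun i h1 h2 => by rw [hv0 i h1 h2]; simp, hvk, hvl, heig, heig] at h1
  have h2 : hM.eigenvalues₀ l * t ^ 2 ≤ hM.eigenvalues₀ k * t ^ 2 :=
    mul_le_mul_of_nonneg_right (hM.eigenvalues₀_antitone hkl.le) (sq_nonneg t)
  by_contra! hlt
  nlinarith [mul_pos (sub_pos.2 hlt) hpos]

theorem le_lambda_one (G : Sym2 V → Bool) (hV : 1 < Fintype.card V) (z : V → ℝ) {c : ℝ}
    (h : ∀ x : V → ℝ, z ⬝ᵥ x = 0 → c * (x ⬝ᵥ x) ≤ x ⬝ᵥ (normalizedLaplacian G *ᵥ x)) :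
    c ≤ lambda G 1 := by
  rw [lambda, dif_pos hV]
  -- In decreasing order λ₀ sits last, at `rev 0`, just after λ₁ at `rev 1`.
  refine le_eigenvalues₀_of_forall_dotProduct_eq_zero _ z h _ (Fin.rev ⟨0, by omega⟩) ?_
  rw [Fin.rev_lt_rev]
  simp [Fin.lt_def]

end RayleighQuotient

/-! ### Counting walks by the vertices they visit -/

section Walks

variable {V : Type*}

/-- A step to a new vertex uses a new edge, because all earlier edges have both ends among the
vertices already visited. -/
theorem card_image_vertices_le [DecidableEq V] (f : ℕ → V) (n : ℕ) :
    ((Finset.range (n + 1)).image f).card ≤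
      ((Finset.range n).image fun i => s(f i, f (i + 1))).card + 1 := by
  induction n with
  | zero => simp
  | succ n ih =>
    rw [Finset.range_add_one (n := n + 1), Finset.image_insert,
      congrArg (Finset.image fun i => s(f i, f (i + 1))) (Finset.range_add_one (n := n)),
      Finset.image_insert (s := Finset.range n)]
    by_cases h : f (n + 1) ∈ (Finset.range (n + 1)).image f
    · rw [Finset.insert_eq_of_mem h]
      exact ih.trans (Nat.succ_le_succ (Finset.card_le_card (Finset.subset_insert _ _)))
    · rw [Finset.card_insert_of_notMem h, Finset.card_insert_of_notMem]
      · omega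
      · intro hmem
        obtain ⟨i, hi, he⟩ := Finset.mem_image.1 hmem
        have hi := Finset.mem_range.1 hi
        have : f (n + 1) ∈ s(f i, f (i + 1)) := he ▸ Sym2.mem_mk_right _ _
        rcases Sym2.mem_iff.1 this with h' | h'
        · exact h (Finset.mem_image.2 ⟨i, Finset.mem_range.2 (by omega), h'.symm⟩)
        · exact h (Finset.mem_image.2 ⟨i + 1, Finset.mem_range.2 (by omega), h'.symm⟩)

/-- A walk with `n` steps visits at most one vertex more than it uses edges. -/
theorem card_image_walk_le [DecidableEq V] {n : ℕ} (f : Fin (n + 1) → V) :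
    (Finset.univ.image f).card ≤
      (Finset.univ.image fun i : Fin n => s(f i.castSucc, f i.succ)).card + 1 := by
  set g : ℕ → V := fun i => f (Fin.ofNat (n + 1) i) with hg
  have hgi : ∀ i (hi : i < n + 1), g i = f ⟨i, hi⟩ := fun i hi => by
    simp only [hg]; congr 1; ext; simp [Nat.mod_eq_of_lt hi]
  have h1 : Finset.univ.image f = (Finset.range (n + 1)).image g := by
    ext v
    simp only [Finset.mem_image, Finset.mem_univ, true_and, Finset.mem_range]
    constructor
    · rintro ⟨i, rfl⟩; exact ⟨i, i.2, hgi i i.2⟩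
    · rintro ⟨i, hi, rfl⟩; exact ⟨⟨i, hi⟩, (hgi i hi).symm⟩
  have h2 : (Finset.univ.image fun i : Fin n => s(f i.castSucc, f i.succ)) =
      (Finset.range n).image fun i => s(g i, g (i + 1)) := by
    ext v
    simp only [Finset.mem_image, Finset.mem_univ, true_and, Finset.mem_range]
    constructor
    · rintro ⟨i, rfl⟩
      exact ⟨i, i.2, by rw [hgi i (by omega), hgi (i + 1) (by omega)]; rfl⟩
    · rintro ⟨i, hi, rfl⟩
      exact ⟨⟨i, hi⟩, by rw [hgi i (by omega), hgi (i + 1) (by omega)]; rfl⟩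
  rw [h1, h2]
  exact card_image_vertices_le g n

/-- Sequences of vertices, each weighted by `|V|⁻¹` for every vertex that it visits. -/
theorem sum_inv_pow_card_image_le [Fintype V] [DecidableEq V] [Nonempty V] (n : ℕ) :
    ∑ f : Fin n → V, ((Fintype.card V : ℝ)⁻¹) ^ (Finset.univ.image f).card ≤ n.factorial := by
  have hN : (0 : ℝ) < Fintype.card V := Nat.cast_pos.2 Fintype.card_pos
  induction n with
  | zero => simp
  | succ n ih =>
    rw [← (Fin.consEquiv fun _ : Fin (n + 1) => V).sum_comp, Fintype.sum_prod_type_right]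
    -- Prepend `v` to `f`: the at most `n` values already visited keep the weight, and the new ones,
    -- of relative weight `|V|⁻¹` each, contribute at most `1` in total.
    have hstep : ∀ f : Fin n → V,
        ∑ v, ((Fintype.card V : ℝ)⁻¹) ^
          (Finset.univ.image ((Fin.consEquiv fun _ : Fin (n + 1) => V) (v, f))).card ≤
        (n + 1) * ((Fintype.card V : ℝ)⁻¹) ^ (Finset.univ.image f).card := by
      intro f
      set S := Finset.univ.image f with hS
      have him : ∀ v, Finset.univ.image ((Fin.consEquiv fun _ : Fin (n + 1) => V) (v, f)) =
          insert v S := by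
        intro v
        ext x
        simp [hS, Fin.consEquiv, Fin.exists_fin_succ, eq_comm]
      have hle : ∀ v, ((Fintype.card V : ℝ)⁻¹) ^ (insert v S).card ≤
          (if v ∈ S then 1 else 0) * ((Fintype.card V : ℝ)⁻¹) ^ S.card +
            (Fintype.card V : ℝ)⁻¹ * ((Fintype.card V : ℝ)⁻¹) ^ S.card := by
        intro v
        by_cases hv : v ∈ S
        · rw [Finset.insert_eq_of_mem hv, if_pos hv, one_mul]
          exact le_add_of_nonneg_right (by positivity)
        · rw [Finset.card_insert_of_notMem hv, if_neg hv, pow_succ', zero_mul, zero_add]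
      have hSn : (S.card : ℝ) ≤ n := by
        exact_mod_cast Finset.card_image_le.trans_eq (Finset.card_fin n)
      calc _ ≤ ∑ v, ((if v ∈ S then 1 else 0) * ((Fintype.card V : ℝ)⁻¹) ^ S.card +
            (Fintype.card V : ℝ)⁻¹ * ((Fintype.card V : ℝ)⁻¹) ^ S.card) :=
          Finset.sum_le_sum fun v _ => by rw [him v]; exact hle v
        _ = (S.card + 1) * ((Fintype.card V : ℝ)⁻¹) ^ S.card := by
          rw [Finset.sum_add_distrib, ← Finset.sum_mul, Finset.sum_const, Finset.card_univ,
            nsmul_eq_mul, ← mul_assoc, mul_inv_cancel₀ hN.ne']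
          simp [add_mul]
        _ ≤ _ := by gcongr
    calc _ ≤ ∑ f : Fin n → V, (n + 1) * ((Fintype.card V : ℝ)⁻¹) ^ (Finset.univ.image f).card :=
          Finset.sum_le_sum fun f _ => hstep f
      _ ≤ (n + 1) * n.factorial := by rw [← Finset.mul_sum]; gcongr
      _ = _ := by push_cast [Nat.factorial_succ]; ring

theorem pow_apply_eq_sum_walks [Fintype V] [DecidableEq V] (M : Matrix V V ℝ) (n : ℕ) (x y : V) :
    (M ^ n) x y = ∑ f : Fin (n + 1) → V,
      if f 0 = x ∧ f (Fin.last n) = y then ∏ i : Fin n, M (f i.castSucc) (f i.succ) else 0 := by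
  induction n generalizing x with
  | zero =>
    rw [← (Equiv.funUnique (Fin 1) V).symm.sum_comp]
    by_cases h : x = y
    · subst h
      simp
    · have : ∀ v : V, ¬(v = x ∧ v = y) := fun v hv => h (hv.1.symm.trans hv.2)
      simp [this, Matrix.one_apply_ne h]
  | succ n ih =>
    rw [← (Fin.consEquiv fun _ : Fin (n + 2) => V).sum_comp, Fintype.sum_prod_type_right, pow_succ',
      Matrix.mul_apply]
    simp only [ih, Finset.mul_sum]
    rw [Finset.sum_comm]
    refine Finset.sum_congr rfl fun f _ => ?_
    simp only [Fin.consEquiv, Equiv.coe_fn_mk, Fin.cons_zero, ← Fin.succ_last, Fin.cons_succ,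
      Fin.prod_univ_succ (n := n), Fin.castSucc_zero, ← Fin.succ_castSucc]
    by_cases h : f (Fin.last n) = y
    · simp [h]
    · simp [h]

theorem trace_pow_eq_sum_walks [Fintype V] [DecidableEq V] (M : Matrix V V ℝ) (n : ℕ) :
    (M ^ n).trace = ∑ f : Fin (n + 1) → V,
      if f 0 = f (Fin.last n) then ∏ i : Fin n, M (f i.castSucc) (f i.succ) else 0 := by
  simp only [Matrix.trace, Matrix.diag, pow_apply_eq_sum_walks]
  rw [Finset.sum_comm]
  refine Finset.sum_congr rfl fun f _ => ?_
  simp [ite_and, eq_comm]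

end Walks

/-! ### Trace moments for independent centred entries -/

section Moments

variable {V : Type*} [Fintype V] [DecidableEq V]

/-- Grouping the steps by edge lets independence factor the expectation; the exponents count
traversals. -/
theorem integral_prod_walk_eq (ν : Sym2 V → Measure Bool) [∀ e, IsProbabilityMeasure (ν e)]
    (g : Sym2 V → Bool → ℝ) {n : ℕ} (f : Fin (n + 1) → V) :
    ∫ ω, ∏ i : Fin n, g s(f i.castSucc, f i.succ) (ω s(f i.castSucc, f i.succ)) ∂Measure.pi ν =
      ∏ e, ∫ b, g e b ^ (Finset.univ.filter fun i : Fin n => s(f i.castSucc, f i.succ) = e).card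
        ∂ν e := by
  rw [← integral_fintype_prod_eq_prod (μ := ν)]
  refine integral_congr_ae (ae_of_all _ fun ω => ?_)
  dsimp only
  rw [← Finset.prod_fiberwise Finset.univ fun i : Fin n => s(f i.castSucc, f i.succ)]
  refine Finset.prod_congr rfl fun e _ => ?_
  rw [← Finset.prod_const]
  refine Finset.prod_congr rfl fun i hi => ?_
  rw [(Finset.mem_filter.1 hi).2]

/-- An edge traversed once has mean zero; every other used edge gives `|V|⁻¹`. Trading edges for
vertices costs the one extra factor `|V|`. -/
theorem abs_integral_prod_walk_le [Nonempty V] (ν : Sym2 V → Measure Bool)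
    [∀ e, IsProbabilityMeasure (ν e)] (g : Sym2 V → Bool → ℝ) {ρ : ℝ} (hρ : 0 ≤ ρ)
    (hmean : ∀ e, ∫ b, g e b ∂ν e = 0)
    (hmom : ∀ e m, 2 ≤ m → |∫ b, g e b ^ m ∂ν e| ≤ ρ ^ m * (Fintype.card V : ℝ)⁻¹)
    {n : ℕ} (f : Fin (n + 1) → V) :
    |∫ ω, ∏ i : Fin n, g s(f i.castSucc, f i.succ) (ω s(f i.castSucc, f i.succ)) ∂Measure.pi ν| ≤
      ρ ^ n * Fintype.card V * ((Fintype.card V : ℝ)⁻¹) ^ (Finset.univ.image f).card := by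
  have hN : (1 : ℝ) ≤ Fintype.card V := Nat.one_le_cast.2 Fintype.card_pos
  set c := fun e : Sym2 V =>
    (Finset.univ.filter fun i : Fin n => s(f i.castSucc, f i.succ) = e).card with hc
  set E := Finset.univ.image fun i : Fin n => s(f i.castSucc, f i.succ) with hE
  have hcE : ∀ e, c e ≠ 0 → e ∈ E := by
    intro e he
    obtain ⟨i, hi⟩ := Finset.card_pos.1 (Nat.pos_of_ne_zero he)
    exact Finset.mem_image.2 ⟨i, Finset.mem_univ _, (Finset.mem_filter.1 hi).2⟩
  have hEc : ∀ e, e ∈ E → c e ≠ 0 := by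
    intro e he
    obtain ⟨i, -, hi⟩ := Finset.mem_image.1 he
    exact (Finset.card_pos.2 ⟨i, Finset.mem_filter.2 ⟨Finset.mem_univ _, hi⟩⟩).ne'
  have hterm : ∀ e, |∫ b, g e b ^ c e ∂ν e| ≤
      ρ ^ c e * (if e ∈ E then (Fintype.card V : ℝ)⁻¹ else 1) := by
    intro e
    by_cases he : e ∈ E
    · rw [if_pos he]
      rcases (show c e = 1 ∨ 2 ≤ c e by have := hEc e he; omega) with h1 | h2
      · rw [h1]
        simp only [pow_one, hmean, abs_zero]
        positivity
      · exact hmom e _ h2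
    · have : c e = 0 := by_contra fun h => he (hcE e h)
      rw [if_neg he, this]
      simp only [pow_zero, integral_const, probReal_univ, smul_eq_mul, mul_one, abs_one, le_refl]
  have hsum : ∑ e, c e = n := by
    simpa using (Finset.card_eq_sum_card_fiberwise (s := (Finset.univ : Finset (Fin n)))
      (t := Finset.univ) (f := fun i : Fin n => s(f i.castSucc, f i.succ))
      (fun _ _ => Finset.mem_coe.2 (Finset.mem_univ _))).symm
  rw [integral_prod_walk_eq, Finset.abs_prod]
  calc ∏ e, |∫ b, g e b ^ c e ∂ν e|
      ≤ ∏ e, ρ ^ c e * (if e ∈ E then (Fintype.card V : ℝ)⁻¹ else 1) :=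
        Finset.prod_le_prod (fun _ _ => abs_nonneg _) fun e _ => hterm e
    _ = ρ ^ n * ((Fintype.card V : ℝ)⁻¹) ^ E.card := by
        rw [Finset.prod_mul_distrib, Finset.prod_pow_eq_pow_sum, hsum, Finset.prod_ite_mem]
        simp
    _ = ρ ^ n * Fintype.card V * ((Fintype.card V : ℝ)⁻¹) ^ (E.card + 1) := by
        rw [pow_succ]; field_simp
    _ ≤ _ := by
        refine mul_le_mul_of_nonneg_left ?_ (by positivity)
        exact pow_le_pow_of_le_one (by positivity) (inv_le_one_of_one_le₀ hN)
          (card_image_walk_le f)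

/-- The trace moments of a symmetric random matrix with independent centred entries. -/
theorem integral_trace_pow_le [Nonempty V] (ν : Sym2 V → Measure Bool)
    [∀ e, IsProbabilityMeasure (ν e)] (g : Sym2 V → Bool → ℝ) {ρ : ℝ} (hρ : 0 ≤ ρ)
    (hmean : ∀ e, ∫ b, g e b ∂ν e = 0)
    (hmom : ∀ e m, 2 ≤ m → |∫ b, g e b ^ m ∂ν e| ≤ ρ ^ m * (Fintype.card V : ℝ)⁻¹) (n : ℕ) :
    ∫ ω, ((Matrix.of fun x y => g s(x, y) (ω s(x, y))) ^ n).trace ∂Measure.pi ν ≤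
      Fintype.card V * (n + 1).factorial * ρ ^ n := by
  simp only [trace_pow_eq_sum_walks, Matrix.of_apply]
  rw [integral_finsetSum _ fun _ _ => Integrable.of_finite]
  calc _ ≤ ∑ f : Fin (n + 1) → V,
        ρ ^ n * Fintype.card V * ((Fintype.card V : ℝ)⁻¹) ^ (Finset.univ.image f).card := by
        refine Finset.sum_le_sum fun f _ => ?_
        -- Closedness of the walk is discarded: the bound is summed over all vertex sequences.
        split_ifs
        · exact (le_abs_self _).trans (abs_integral_prod_walk_le ν g hρ hmean hmom f)
        · rw [integral_zero]; positivity
    _ ≤ ρ ^ n * Fintype.card V * (n + 1).factorial := by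
        rw [← Finset.mul_sum]
        exact mul_le_mul_of_nonneg_left (sum_inv_pow_card_image_le (n + 1)) (by positivity)
    _ = _ := by ring

end Moments

/-! ### Lower tail of the degrees -/

section Bernoulli

open ProbabilityTheory unitInterval

variable {V : Type*} [Fintype V] [DecidableEq V]

/-- The law of a random graph whose edges are independent, the pair `e` with probability `q e`. -/
noncomputable abbrev edgeLaw (q : Sym2 V → I) : Measure (Sym2 V → Bool) :=
  Measure.pi fun e => bernoulliMeasure true false (q e)

theorem integral_bernoulli_bool (q : I) (f : Bool → ℝ) :
    ∫ b, f b ∂bernoulliMeasure true false q = q * f true + (1 - q) * f false := by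
  rw [integral_bernoulliMeasure]
  simp

/-- The pairs at `x` are distinct, so the degree is a sum of independent indicators. Each factor is
`1 - (1 - e⁻¹) q ≤ 1 - 3q/5 ≤ exp (-3q/5)`. -/
theorem integral_exp_neg_degree_le (q : Sym2 V → I) (x : V) :
    ∫ G, Real.exp (-degree G x) ∂edgeLaw q ≤ Real.exp (-(3 / 5 * ∑ y, (q s(x, y) : ℝ))) := by
  set S := Finset.univ.image fun y : V => s(x, y) with hS
  have hinj : Function.Injective fun y : V => s(x, y) := fun y z h => Sym2.congr_right.1 h
  set h : Sym2 V → Bool → ℝ := fun e b =>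
    if e ∈ S then Real.exp (-(if b then 1 else 0)) else 1 with hh
  have h1 : ∀ G : Sym2 V → Bool, Real.exp (-degree G x) = ∏ e, h e (G e) := by
    intro G
    simp only [hh, degree, adjMatrix, Matrix.of_apply]
    rw [← Finset.sum_neg_distrib, Real.exp_sum, Finset.prod_ite_mem, Finset.univ_inter, hS,
      Finset.prod_image fun y _ z _ hyz => hinj hyz]
  have h2 : ∀ e, ∫ b, h e b ∂bernoulliMeasure true false (q e) ≤
      if e ∈ S then Real.exp (-(3 / 5 * (q e : ℝ))) else 1 := by
    intro e
    rw [integral_bernoulli_bool]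
    by_cases he : e ∈ S
    · simp only [hh, if_pos he]
      have h3 : Real.exp (-1) ≤ 2 / 5 := by
        have := Real.exp_neg_one_lt_d9
        linarith
      have h4 := Real.add_one_le_exp (-(3 / 5 * (q e : ℝ)))
      have h5 := (q e).2.1
      simp only [if_true, Bool.false_eq_true, if_false, neg_zero, Real.exp_zero]
      nlinarith
    · simp [hh, if_neg he]
  have h0 : ∀ e, 0 ≤ ∫ b, h e b ∂bernoulliMeasure true false (q e) := fun e =>
    integral_nonneg fun b => by simp only [hh]; split_ifs <;> positivity
  simp only [h1]
  rw [edgeLaw, integral_fintype_prod_eq_prod]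
  refine (Finset.prod_le_prod (fun e _ => h0 e) fun e _ => h2 e).trans_eq ?_
  rw [Finset.prod_ite_mem, Finset.univ_inter, hS, Finset.prod_image fun y _ z _ hyz => hinj hyz,
    ← Real.exp_sum, Finset.mul_sum, Finset.sum_neg_distrib]

theorem measureReal_degree_le (q : Sym2 V → I) (x : V) (t : ℝ) :
    (edgeLaw q).real {G | degree G x ≤ t} ≤
      Real.exp (t - 3 / 5 * ∑ y, (q s(x, y) : ℝ)) := by
  have h := mul_meas_ge_le_integral_of_nonneg (μ := edgeLaw q)
    (f := fun G => Real.exp (-degree G x)) (ae_of_all _ fun _ => (Real.exp_pos _).le)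
    Integrable.of_finite (Real.exp (-t))
  simp only [Real.exp_le_exp, neg_le_neg_iff] at h
  have h' := h.trans (integral_exp_neg_degree_le q x)
  rw [sub_eq_add_neg, Real.exp_add]
  calc _ = Real.exp t * (Real.exp (-t) * (edgeLaw q).real {G | degree G x ≤ t}) := by
        rw [← mul_assoc, ← Real.exp_add]; simp
    _ ≤ _ := by gcongr

end Bernoulli

/-! ### From small fluctuations to a spectral gap -/

section SpectralGap

open ProbabilityTheory unitInterval Matrix

variable {V : Type*}

/-- The centred indicator of an edge, normalised by the prescribed degrees `d` of its ends. -/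
noncomputable def centredEntry (q : Sym2 V → I) (d : V → ℝ) (e : Sym2 V) (b : Bool) : ℝ :=
  ((if b then 1 else 0) - q e) *
    Sym2.lift ⟨fun x y => (Real.sqrt (d x))⁻¹ * (Real.sqrt (d y))⁻¹, fun _ _ => mul_comm _ _⟩ e

/-- The matrix `D ^ (-1/2) (A - 𝔼 A) D ^ (-1/2)` for the prescribed degrees `D = diag d`. -/
noncomputable def centredMatrix (q : Sym2 V → I) (d : V → ℝ) (G : Sym2 V → Bool) : Matrix V V ℝ :=
  Matrix.of fun x y => centredEntry q d s(x, y) (G s(x, y))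

theorem centredMatrix_isHermitian (q : Sym2 V → I) (d : V → ℝ) (G : Sym2 V → Bool) :
    (centredMatrix q d G).IsHermitian := by
  ext x y
  simp [centredMatrix, Sym2.eq_swap]

theorem centredMatrix_apply (q : Sym2 V → I) (d : V → ℝ) (G : Sym2 V → Bool) (x y : V) :
    centredMatrix q d G x y =
      (adjMatrix G x y - q s(x, y)) * ((Real.sqrt (d x))⁻¹ * (Real.sqrt (d y))⁻¹) := rfl

theorem integral_centredEntry (q : Sym2 V → I) (d : V → ℝ) (e : Sym2 V) :
    ∫ b, centredEntry q d e b ∂bernoulliMeasure true false (q e) = 0 := by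
  rw [integral_bernoulli_bool]
  simp only [centredEntry, if_true, Bool.false_eq_true, if_false]
  ring

variable [Fintype V]

/-- With `s = (d x * d y)^(-1/2)`, `hρd` gives `s ≤ ρ` and `hq` bounds the variance: `s² q ≤ ρ² /
|V|`. A higher moment costs one more factor `s` per power. -/
theorem abs_integral_centredEntry_pow_le (q : Sym2 V → I) {d : V → ℝ} (hd : ∀ x, 0 < d x) {ρ : ℝ}
    (hρ : 0 ≤ ρ) (hρd : ∀ x, 1 ≤ ρ * d x)
    (hq : ∀ x y, Fintype.card V * (q s(x, y) : ℝ) ≤ ρ ^ 2 * (d x * d y))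
    (e : Sym2 V) (m : ℕ) (hm : 2 ≤ m) :
    |∫ b, centredEntry q d e b ^ m ∂bernoulliMeasure true false (q e)| ≤
      ρ ^ m * (Fintype.card V : ℝ)⁻¹ := by
  induction e with | _ x y
  have : Nonempty V := ⟨x⟩
  have hN : (0 : ℝ) < Fintype.card V := Nat.cast_pos.2 Fintype.card_pos
  rw [integral_bernoulli_bool]
  simp only [centredEntry, if_true, Bool.false_eq_true, if_false, Sym2.lift_mk]
  have hx := hd x
  have hy := hd y
  have hQ := hq x y
  obtain ⟨t0, t1⟩ := (q s(x, y)).2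
  set t : ℝ := Subtype.val (q s(x, y))
  set s := (Real.sqrt (d x))⁻¹ * (Real.sqrt (d y))⁻¹ with hs
  have hs0 : 0 ≤ s := by positivity
  have hs2 : s ^ 2 * (d x * d y) = 1 := by
    have h1 := Real.sq_sqrt hx.le
    have h2 := Real.sq_sqrt hy.le
    have h3 := (Real.sqrt_pos.2 hx).ne'
    have h4 := (Real.sqrt_pos.2 hy).ne'
    rw [hs, mul_pow, inv_pow, inv_pow, h1, h2]
    field_simp
  have hxy : 0 < d x * d y := mul_pos hx hy
  have hsρ : s ≤ ρ := by
    refine le_of_sq_le_sq ?_ hρ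
    have h1 : 1 ≤ (ρ * d x) * (ρ * d y) := one_le_mul_of_one_le_of_one_le (hρd x) (hρd y)
    nlinarith
  have hst : s ^ 2 * t ≤ ρ ^ 2 * (Fintype.card V : ℝ)⁻¹ := by
    rw [← div_eq_mul_inv, le_div_iff₀ hN]
    nlinarith [mul_le_mul_of_nonneg_left hQ (sq_nonneg s)]
  obtain ⟨k, rfl⟩ : ∃ k, m = k + 2 := ⟨m - 2, by omega⟩
  have h1 : (1 - t) ^ (k + 2) ≤ 1 - t := pow_le_of_le_one (by linarith) (by linarith) (by omega)
  have h2 : t ^ (k + 2) ≤ t ^ 2 := pow_le_pow_of_le_one t0 t1 (by omega)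
  calc |t * ((1 - t) * s) ^ (k + 2) + (1 - t) * ((0 - t) * s) ^ (k + 2)|
      ≤ |t * ((1 - t) * s) ^ (k + 2)| + |(1 - t) * ((0 - t) * s) ^ (k + 2)| := abs_add_le _ _
    _ = (t * (1 - t) ^ (k + 2) + (1 - t) * t ^ (k + 2)) * s ^ (k + 2) := by
        simp only [abs_mul, abs_pow, mul_pow, zero_sub, abs_neg, abs_of_nonneg t0, abs_of_nonneg hs0,
          abs_of_nonneg (sub_nonneg.2 t1)]
        ring
    _ ≤ t * s ^ (k + 2) := by
        refine mul_le_mul_of_nonneg_right ?_ (by positivity)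
        -- Reduces to `t(1-t) + (1-t)t² = t(1-t²) ≤ t`.
        nlinarith [mul_nonneg t0 t0, mul_nonneg t0 (sub_nonneg.2 t1),
          mul_nonneg (mul_nonneg t0 t0) t0]
    _ = s ^ k * (s ^ 2 * t) := by ring
    _ ≤ ρ ^ k * (ρ ^ 2 * (Fintype.card V : ℝ)⁻¹) := by gcongr
    _ = _ := by ring

variable [DecidableEq V]

theorem measureReal_trace_centredMatrix_pow_ge [Nonempty V] (q : Sym2 V → I) {d : V → ℝ}
    (hd : ∀ x, 0 < d x) {ρ : ℝ} (hρ : 0 ≤ ρ) (hρd : ∀ x, 1 ≤ ρ * d x)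
    (hq : ∀ x y, Fintype.card V * (q s(x, y) : ℝ) ≤ ρ ^ 2 * (d x * d y))
    {n : ℕ} (hn : Even n) {δ : ℝ} (hδ : 0 < δ) :
    (edgeLaw q).real {G | δ ^ n ≤ (centredMatrix q d G ^ n).trace} ≤
      Fintype.card V * (n + 1).factorial * (ρ / δ) ^ n := by
  have h := mul_meas_ge_le_integral_of_nonneg (μ := edgeLaw q)
    (f := fun G => (centredMatrix q d G ^ n).trace) (ae_of_all _ fun G => by
      dsimp only
      rw [trace_pow_eq_sum_eigenvalues_pow (centredMatrix_isHermitian q d G)]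
      exact Finset.sum_nonneg fun _ _ => hn.pow_nonneg _)
    Integrable.of_finite (δ ^ n)
  have h' := h.trans (integral_trace_pow_le _ (centredEntry q d) hρ (integral_centredEntry q d)
    (abs_integral_centredEntry_pow_le q hd hρ hρd hq) n)
  rw [div_pow, ← mul_div_assoc, le_div_iff₀ (by positivity), mul_comm]
  exact h'

theorem dotProduct_normalizedLaplacian_mulVec (G : Sym2 V → Bool) (x : V → ℝ) :
    x ⬝ᵥ (normalizedLaplacian G *ᵥ x) = x ⬝ᵥ x -
      (fun v => (Real.sqrt (degree G v))⁻¹ * x v) ⬝ᵥ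
        (adjMatrix G *ᵥ fun v => (Real.sqrt (degree G v))⁻¹ * x v) := by
  have h : invSqrtDegMatrix G *ᵥ x = fun v => (Real.sqrt (degree G v))⁻¹ * x v := by
    ext v
    rw [invSqrtDegMatrix, mulVec_diagonal]
  rw [normalizedLaplacian, sub_mulVec, one_mulVec, dotProduct_sub, ← mulVec_mulVec,
    ← mulVec_mulVec, h]
  congr 1
  simp only [dotProduct, invSqrtDegMatrix, mulVec_diagonal]
  exact Finset.sum_congr rfl fun v _ => by ring

/-- If all degrees are comparable to the prescribed ones, the expected adjacency matrix is
nonpositive on a hyperplane, and the centred matrix is small, then `λ₁` is close to `1`. -/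
theorem one_sub_le_lambda_one (q : Sym2 V → I) {d : V → ℝ} (hd : ∀ x, 0 < d x)
    (hV : 1 < Fintype.card V) (z : V → ℝ)
    (hz : ∀ y : V → ℝ, z ⬝ᵥ y = 0 → ∑ u, ∑ v, (q s(u, v) : ℝ) * (y u * y v) ≤ 0)
    (G : Sym2 V → Bool) (hdeg : ∀ x, d x / 4 < degree G x) {n : ℕ} (hn : Even n) (hn0 : n ≠ 0)
    {δ : ℝ} (hδ : 0 ≤ δ) (htr : (centredMatrix q d G ^ n).trace ≤ δ ^ n) :
    1 - 4 * δ ≤ lambda G 1 := by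
  -- The hyperplane depends on `G`, so that `y = D^(-1/2) x` becomes orthogonal to `z`.
  refine le_lambda_one G hV (fun v => z v * (Real.sqrt (degree G v))⁻¹) fun x hx => ?_
  rw [dotProduct_normalizedLaplacian_mulVec]
  set y : V → ℝ := fun v => (Real.sqrt (degree G v))⁻¹ * x v with hy
  have hzy : z ⬝ᵥ y = 0 := by
    rw [← hx]
    exact Finset.sum_congr rfl fun v _ => by simp only [hy]; ring
  have h1 := hz y hzy
  -- Testing at `√d * y` undoes the normalisation by `d`, leaving the form of `A - 𝔼 A` at `y`.
  have h2 := dotProduct_mulVec_le_of_trace_pow_le (centredMatrix_isHermitian q d G) hn hn0 hδ htr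
    fun v => Real.sqrt (d v) * y v
  have h3 : (fun v => Real.sqrt (d v) * y v) ⬝ᵥ
      (centredMatrix q d G *ᵥ fun v => Real.sqrt (d v) * y v) =
      y ⬝ᵥ (adjMatrix G *ᵥ y) - ∑ u, ∑ v, (q s(u, v) : ℝ) * (y u * y v) := by
    simp only [dotProduct, mulVec, Finset.mul_sum, ← Finset.sum_sub_distrib]
    refine Finset.sum_congr rfl fun u _ => Finset.sum_congr rfl fun v _ => ?_
    have hu := (Real.sqrt_pos.2 (hd u)).ne'
    have hv := (Real.sqrt_pos.2 (hd v)).ne'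
    rw [centredMatrix_apply]
    field_simp
  have h4 : (fun v => Real.sqrt (d v) * y v) ⬝ᵥ (fun v => Real.sqrt (d v) * y v) ≤
      4 * (x ⬝ᵥ x) := by
    simp only [dotProduct, Finset.mul_sum]
    refine Finset.sum_le_sum fun v _ => ?_
    have hD : 0 < degree G v := lt_trans (by have := hd v; positivity) (hdeg v)
    have e1 := Real.mul_self_sqrt (hd v).le
    have e2 := Real.mul_self_sqrt hD.le
    have e3 : Real.sqrt (d v) * y v * (Real.sqrt (d v) * y v) = d v / degree G v * (x v * x v) := by
      simp only [hy]
      calc _ = (Real.sqrt (d v) * Real.sqrt (d v)) *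
            (Real.sqrt (degree G v) * Real.sqrt (degree G v))⁻¹ * (x v * x v) := by
            rw [mul_inv]; ring
        _ = _ := by rw [e1, e2, div_eq_mul_inv]
    rw [e3]
    refine mul_le_mul_of_nonneg_right ?_ (mul_self_nonneg _)
    rw [div_le_iff₀ hD]
    linarith [hdeg v]
  nlinarith [mul_le_mul_of_nonneg_left h4 hδ]

/-- A nonasymptotic form of the spectral gap for graphs with independent edges. -/
theorem measureReal_lambda_one_lt_le (q : Sym2 V → I) {d : V → ℝ}
    (hV : 1 < Fintype.card V) (z : V → ℝ)
    (hz : ∀ y : V → ℝ, z ⬝ᵥ y = 0 → ∑ u, ∑ v, (q s(u, v) : ℝ) * (y u * y v) ≤ 0)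
    (hdq : ∀ x, d x / 2 ≤ ∑ y, (q s(x, y) : ℝ))
    {ρ : ℝ} (hρ : 0 < ρ) (hρd : ∀ x, 1 ≤ ρ * d x)
    (hq : ∀ x y, Fintype.card V * (q s(x, y) : ℝ) ≤ ρ ^ 2 * (d x * d y))
    {n : ℕ} (hn : Even n) (hn0 : n ≠ 0) {δ : ℝ} (hδ : 0 < δ) :
    (edgeLaw q).real {G | lambda G 1 < 1 - 4 * δ} ≤
      Fintype.card V * Real.exp (-(20 * ρ)⁻¹) +
        Fintype.card V * (n + 1).factorial * (ρ / δ) ^ n := by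
  have : Nonempty V := Fintype.card_pos_iff.1 (by omega)
  have hd : ∀ x, 0 < d x := fun x => pos_of_mul_pos_right (zero_lt_one.trans_le (hρd x)) hρ.le
  have hsub : {G | lambda G 1 < 1 - 4 * δ} ⊆
      (⋃ x ∈ Finset.univ, {G | degree G x ≤ d x / 4}) ∪
        {G | δ ^ n ≤ (centredMatrix q d G ^ n).trace} := by
    intro G hG
    by_contra hcon
    simp only [Set.mem_union, Set.mem_iUnion, Set.mem_ofPred_eq, Finset.mem_univ, exists_const,
      not_or, not_exists, not_le] at hcon
    exact absurd (one_sub_le_lambda_one q hd hV z hz G hcon.1 hn hn0 hδ.le hcon.2.le)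
      (not_le.2 hG)
  refine (measureReal_mono hsub).trans ((measureReal_union_le _ _).trans (add_le_add ?_
    (measureReal_trace_centredMatrix_pow_ge q hd hρ.le hρd hq hn hδ)))
  refine (measureReal_biUnion_finset_le _ _).trans ?_
  rw [← nsmul_eq_mul]
  refine Finset.sum_le_card_nsmul _ _ _ fun x _ => (measureReal_degree_le q x _).trans ?_
  rw [Real.exp_le_exp]
  -- The exponent is at most `d/4 - (3/5)(d/2) = -d/20`.
  have h1 : ρ⁻¹ ≤ d x := by
    rw [inv_le_iff_one_le_mul₀' hρ]; exact hρd x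
  have h2 := hdq x
  rw [mul_inv]
  linarith

end SpectralGap

/-! ### The weighted model: rank-two structure and parameters -/

section Model

variable {m₁ m₂ : ℕ}

/-- The weight of a vertex `x` itself, read as `0` on `V₃`. -/
def outWeight (w : Fin m₁ ⊕ Fin m₂ → ℝ) : Vertex m₁ m₂ → ℝ
  | Sum.inl i => w (Sum.inl i)
  | Sum.inr (Sum.inl j) => w (Sum.inr j)
  | Sum.inr (Sum.inr _) => 0

/-- The weight of the inverse of a vertex `x`, read as `0` on `V₂`. -/
def inWeight (w : Fin m₁ ⊕ Fin m₂ → ℝ) (star : Fin m₁ → Fin m₁) : Vertex m₁ m₂ → ℝ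
  | Sum.inl i => w (Sum.inl (star i))
  | Sum.inr (Sum.inl _) => 0
  | Sum.inr (Sum.inr j) => w (Sum.inr j)

variable {w : Fin m₁ ⊕ Fin m₂ → ℝ} {star : Fin m₁ → Fin m₁}

/-- The zero conventions make one formula cover all pairs, including the absence of edges inside
`V₂` and `V₃`. -/
theorem edgeWeight_eq (x y : Vertex m₁ m₂) :
    edgeWeight w star x y =
      outWeight w x * inWeight w star y + inWeight w star x * outWeight w y := by
  rcases x with i | i | i <;> rcases y with j | j | j <;>
    simp only [edgeWeight, outWeight, inWeight] <;> ring

theorem outWeight_nonneg (hw : ∀ a, 0 ≤ w a) (x : Vertex m₁ m₂) : 0 ≤ outWeight w x := by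
  rcases x with i | i | i <;> simp [outWeight, hw]

theorem inWeight_nonneg (hw : ∀ a, 0 ≤ w a) (x : Vertex m₁ m₂) : 0 ≤ inWeight w star x := by
  rcases x with i | i | i <;> simp [inWeight, hw]

theorem le_outWeight_add_inWeight {c : ℝ} (hc : 0 ≤ c) (hw : ∀ a, c ≤ w a) (x : Vertex m₁ m₂) :
    c ≤ outWeight w x + inWeight w star x := by
  rcases x with i | i | i
  · exact (hw _).trans (le_add_of_nonneg_right (hc.trans (hw _)))
  · simp [outWeight, inWeight, hw]
  · simp [outWeight, inWeight, hw]

theorem sum_outWeight : ∑ x, outWeight w x = ∑ a, w a := by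
  simp [Fintype.sum_sum_type, outWeight]

theorem sum_inWeight (hstar : Function.Involutive star) : ∑ x, inWeight w star x = ∑ a, w a := by
  simp only [Fintype.sum_sum_type, inWeight, Finset.sum_const_zero, zero_add]
  congr 1
  exact Equiv.sum_comp hstar.toPerm fun i => w (Sum.inl i)

/-- As `star` has no fixed point, the two weights at a vertex of `V₁` are distinct terms of the sum.
This bounds the mass of a loop. -/
theorem outWeight_add_inWeight_le_sum (hw : ∀ a, 0 ≤ w a) (hne : ∀ i, star i ≠ i)
    (x : Vertex m₁ m₂) : outWeight w x + inWeight w star x ≤ ∑ a, w a := by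
  rcases x with i | i | i
  · simp only [outWeight, inWeight]
    rw [← Finset.sum_pair (f := w) (fun h => hne i (Sum.inl_injective h).symm)]
    exact Finset.sum_le_sum_of_subset_of_nonneg (Finset.subset_univ _) fun a _ _ => hw a
  · simpa [outWeight, inWeight] using
      Finset.single_le_sum (fun a _ => hw a) (Finset.mem_univ (Sum.inr i))
  · simpa [outWeight, inWeight] using
      Finset.single_le_sum (fun a _ => hw a) (Finset.mem_univ (Sum.inr i))

theorem edgeProb_mk (loops : Bool) (p : ℝ) (x y : Vertex m₁ m₂) :
    edgeProb loops w p star s(x, y) =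
      if x = y ∧ loops = false then 0 else edgeWeight w star x y * p := rfl

theorem edgeWeight_nonneg (hw : ∀ a, 0 ≤ w a) (x y : Vertex m₁ m₂) :
    0 ≤ edgeWeight w star x y := by
  rw [edgeWeight_eq]
  exact add_nonneg (mul_nonneg (outWeight_nonneg hw x) (inWeight_nonneg hw y))
    (mul_nonneg (inWeight_nonneg hw x) (outWeight_nonneg hw y))

theorem edgeProb_nonneg (loops : Bool) {p : ℝ} (hp : 0 ≤ p) (hw : ∀ a, 0 ≤ w a)
    (e : Sym2 (Vertex m₁ m₂)) : 0 ≤ edgeProb loops w p star e := by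
  induction e with | _ x y
  rw [edgeProb_mk]
  split_ifs
  · exact le_rfl
  · exact mul_nonneg (edgeWeight_nonneg hw x y) hp

theorem edgeProb_mk_le (loops : Bool) {p : ℝ} (hp : 0 ≤ p) (hw : ∀ a, 0 ≤ w a)
    (x y : Vertex m₁ m₂) : edgeProb loops w p star s(x, y) ≤ edgeWeight w star x y * p := by
  rw [edgeProb_mk]
  split_ifs
  · exact mul_nonneg (edgeWeight_nonneg hw x y) hp
  · exact le_rfl

/-- The expected adjacency matrix is nonpositive on the hyperplane orthogonal to the vector of
expected degrees. -/
theorem sum_edgeProb_mul_nonpos (loops : Bool) {p : ℝ} (hp : 0 ≤ p) (hw : ∀ a, 0 ≤ w a)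
    (y : Vertex m₁ m₂ → ℝ) (hy : ∑ x, (outWeight w x + inWeight w star x) * y x = 0) :
    ∑ u, ∑ v, edgeProb loops w p star s(u, v) * (y u * y v) ≤ 0 := by
  -- Excluding loops removes a nonnegative diagonal, which only decreases the form.
  have h1 : ∑ u, ∑ v, edgeProb loops w p star s(u, v) * (y u * y v) ≤
      ∑ u, ∑ v, edgeWeight w star u v * p * (y u * y v) := by
    refine Finset.sum_le_sum fun u _ => Finset.sum_le_sum fun v _ => ?_
    by_cases huv : u = v
    · subst huv
      exact mul_le_mul_of_nonneg_right (edgeProb_mk_le loops hp hw u u) (mul_self_nonneg _)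
    · rw [edgeProb_mk, if_neg fun h => huv h.1]
  have h2 : ∑ u, ∑ v, edgeWeight w star u v * p * (y u * y v) =
      2 * p * ((∑ u, outWeight w u * y u) * ∑ v, inWeight w star v * y v) := by
    have h3 : ∑ u, ∑ v, edgeWeight w star u v * p * (y u * y v) =
        p * ((∑ u, outWeight w u * y u) * ∑ v, inWeight w star v * y v) +
        p * ((∑ u, inWeight w star u * y u) * ∑ v, outWeight w v * y v) := by
      rw [Finset.sum_mul_sum, Finset.sum_mul_sum]
      simp only [Finset.mul_sum, ← Finset.sum_add_distrib]
      refine Finset.sum_congr rfl fun u _ => Finset.sum_congr rfl fun v _ => ?_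
      rw [edgeWeight_eq]
      ring
    rw [h3]
    ring
  have h4 : ∑ v, inWeight w star v * y v = -∑ u, outWeight w u * y u := by
    simp only [add_mul, Finset.sum_add_distrib] at hy
    linarith
  rw [h2, h4] at h1
  nlinarith [mul_nonneg hp (mul_self_nonneg (∑ u, outWeight w u * y u))]

/-- With loops the row sum is `p S (a + b)`. The loop accounts for `2abp`, at most half of it, since
`4ab ≤ (a + b)² ≤ S (a + b)`. -/
theorem half_expectedDegree_le (loops : Bool) {p : ℝ} (hp : 0 ≤ p) (hw : ∀ a, 0 ≤ w a)
    (hstar : Function.Involutive star) (hne : ∀ i, star i ≠ i) (x : Vertex m₁ m₂) :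
    p * (∑ a, w a) * (outWeight w x + inWeight w star x) / 2 ≤
      ∑ y, edgeProb loops w p star s(x, y) := by
  have h1 : ∑ y, (edgeWeight w star x y * p - if x = y then edgeWeight w star x y * p else 0) ≤
      ∑ y, edgeProb loops w p star s(x, y) := by
    refine Finset.sum_le_sum fun y _ => ?_
    by_cases hxy : x = y
    · rw [if_pos hxy, sub_self]
      exact edgeProb_nonneg loops hp hw _
    · rw [if_neg hxy, sub_zero, edgeProb_mk, if_neg fun h => hxy h.1]
  have h2 : ∑ y, edgeWeight w star x y = (∑ a, w a) * (outWeight w x + inWeight w star x) := by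
    simp only [edgeWeight_eq, Finset.sum_add_distrib, ← Finset.mul_sum, sum_outWeight,
      sum_inWeight hstar]
    ring
  rw [Finset.sum_sub_distrib, ← Finset.sum_mul, h2, Finset.sum_ite_eq, if_pos (Finset.mem_univ _),
    edgeWeight_eq] at h1
  refine le_trans ?_ h1
  have h3 := outWeight_add_inWeight_le_sum hw hne x
  have h4 := add_nonneg (outWeight_nonneg hw x) (inWeight_nonneg (star := star) hw x)
  set a := outWeight w x
  set b := inWeight w star x
  have h5 : 4 * (a * b) ≤ (∑ a, w a) * (a + b) := by nlinarith [sq_nonneg (a - b)]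
  nlinarith [mul_le_mul_of_nonneg_left h5 hp]

theorem factorial_succ_le_pow (n : ℕ) : (n + 1).factorial ≤ (n + 1) ^ n := by
  induction n with
  | zero => simp
  | succ n ih =>
    rw [Nat.factorial_succ, pow_succ']
    gcongr
    exact ih.trans (Nat.pow_le_pow_left (by omega) n)

theorem measureReal_law_lambda_one_lt_le (loops : Bool) {c p : ℝ} (hc : 0 < c)
    (hw : ∀ a, c ≤ w a) (hstar : Function.Involutive star) (hne : ∀ i, star i ≠ i) (hp : 0 ≤ p)
    (hprob : ∀ e, edgeProb loops w p star e ≤ 1)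
    (hlog : 14 ≤ Real.log ((m₁ : ℝ) + 2 * m₂))
    (hdense : 4 * Real.log ((m₁ : ℝ) + 2 * m₂) ^ 6 ≤ ((m₁ : ℝ) + 2 * m₂) * p * c ^ 2) :
    (law loops w p star).real {G | lambda G 1 < 1 - 4 * (Real.log ((m₁ : ℝ) + 2 * m₂))⁻¹} ≤
      2 * ((m₁ : ℝ) + 2 * m₂)⁻¹ := by
  have hw0 : ∀ a, 0 ≤ w a := fun a => hc.le.trans (hw a)
  have hcard : (Fintype.card (Vertex m₁ m₂) : ℝ) = (m₁ : ℝ) + 2 * m₂ := by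
    simp [Vertex]; ring
  set N : ℝ := (m₁ : ℝ) + 2 * m₂ with hN
  set ℓ := Real.log N with hℓ
  have hN0 : 0 < N := by
    have h0 : 0 ≤ N := by positivity
    rcases h0.eq_or_lt with h | h
    · rw [hℓ, ← h, Real.log_zero] at hlog; norm_num at hlog
    · exact h
  have hℓ0 : 0 < ℓ := by linarith
  have hexp : Real.exp ℓ = N := Real.exp_log hN0
  have hN1 : 15 ≤ N := by rw [← hexp]; linarith [Real.add_one_le_exp ℓ]
  set S := ∑ a, w a with hS
  have hSN : c * N ≤ 2 * S := by
    have : ∑ _a : Fin m₁ ⊕ Fin m₂, c ≤ S := Finset.sum_le_sum fun a _ => hw a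
    simp only [Finset.sum_const, Finset.card_univ, Fintype.card_sum, Fintype.card_fin,
      nsmul_eq_mul, Nat.cast_add] at this
    have h1 : 0 ≤ (m₁ : ℝ) * c := by positivity
    rw [hN]; linarith
  have hS0 : 0 < S := by nlinarith
  have hp0 : 0 < p := by
    have : 0 < N * p * c ^ 2 := lt_of_lt_of_le (by positivity) hdense
    by_contra! h
    nlinarith [mul_pos hN0 (pow_pos hc 2)]
  set q : Sym2 (Vertex m₁ m₂) → unitInterval := fun e =>
    Set.projIcc (0 : ℝ) 1 zero_le_one (edgeProb loops w p star e) with hq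
  have hqe : ∀ e, ((q e : unitInterval) : ℝ) = edgeProb loops w p star e := fun e => by
    simp only [hq]
    rw [Set.projIcc_of_mem zero_le_one ⟨edgeProb_nonneg loops hp hw0 e, hprob e⟩]
  set z : Vertex m₁ m₂ → ℝ := fun x => outWeight w x + inWeight w star x with hz
  have hzc : ∀ x, c ≤ z x := fun x => le_outWeight_add_inWeight hc.le hw x
  -- The sixth power of the logarithm is `ρ⁻²`, as the variance bound requires.
  set ρ : ℝ := (ℓ ^ 3)⁻¹ with hρdef
  have hρ : 0 < ρ := by positivity
  have hρℓ : ρ * ℓ ^ 3 = 1 := inv_mul_cancel₀ (by positivity)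
  have hone : 2 ≤ ρ * (N * p * c ^ 2) := by
    have h1 : (1 : ℝ) ≤ ℓ ^ 3 := one_le_pow₀ (by linarith)
    calc (2 : ℝ) ≤ 4 * (ρ * ℓ ^ 3) * ℓ ^ 3 := by rw [hρℓ]; linarith
      _ = ρ * (4 * ℓ ^ 6) := by ring
      _ ≤ _ := by gcongr
  have htwo : 4 ≤ ρ ^ 2 * (N * p * c ^ 2) := by
    calc (4 : ℝ) = 4 * (ρ * ℓ ^ 3) ^ 2 := by rw [hρℓ]; ring
      _ = ρ ^ 2 * (4 * ℓ ^ 6) := by ring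
      _ ≤ _ := by gcongr
  have hρd : ∀ x, 1 ≤ ρ * (p * S * z x) := by
    intro x
    have h1 : ρ * (p * (c * N) * c) ≤ ρ * (p * (2 * S) * z x) := by
      gcongr
      exact hzc x
    nlinarith
  have hvar : ∀ x y, Fintype.card (Vertex m₁ m₂) * (q s(x, y) : ℝ) ≤
      ρ ^ 2 * ((p * S * z x) * (p * S * z y)) := by
    intro x y
    rw [hcard, hqe]
    have hx : 0 ≤ z x := hc.le.trans (hzc x)
    have hy : 0 ≤ z y := hc.le.trans (hzc y)
    have h1 : edgeProb loops w p star s(x, y) ≤ z x * z y * p := by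
      refine (edgeProb_mk_le loops hp hw0 x y).trans ?_
      rw [edgeWeight_eq]
      gcongr
      simp only [hz]
      nlinarith [mul_nonneg (outWeight_nonneg hw0 x) (outWeight_nonneg hw0 y),
        mul_nonneg (inWeight_nonneg (star := star) hw0 x) (inWeight_nonneg (star := star) hw0 y)]
    have h2 : (c * N) ^ 2 ≤ (2 * S) ^ 2 := by gcongr
    -- The vertex weights cancel from the variance condition. The `4` in `hdense` pays for `S ≥ c N
    -- / 2`, squared.
    have h3 : N ≤ ρ ^ 2 * p * S ^ 2 := by
      have h4 : 4 * N ≤ ρ ^ 2 * (N * p * c ^ 2) * N := by gcongr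
      have h5 : ρ ^ 2 * p * (c * N) ^ 2 ≤ ρ ^ 2 * p * (2 * S) ^ 2 := by gcongr
      nlinarith
    calc N * edgeProb loops w p star s(x, y) ≤ (ρ ^ 2 * p * S ^ 2) * (z x * z y * p) := by
          gcongr
          exact edgeProb_nonneg loops hp hw0 _
      _ = _ := by ring
  -- `k ≥ ℓ` makes `e^(-2k) ≤ N⁻²`; `k < ℓ + 1` keeps `2k + 1 ≤ 5ℓ`.
  obtain ⟨k, hk1, hk2⟩ : ∃ k : ℕ, ℓ ≤ k ∧ (k : ℝ) < ℓ + 1 :=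
    ⟨⌈ℓ⌉₊, Nat.le_ceil _, Nat.ceil_lt_add_one hℓ0.le⟩
  have hk0 : 2 * k ≠ 0 := by
    rintro h
    have : k = 0 := by omega
    subst this
    norm_num at hk1
    linarith
  have main := measureReal_lambda_one_lt_le q (d := fun x => p * S * z x)
    (by
      have : (1 : ℝ) < Fintype.card (Vertex m₁ m₂) := by rw [hcard]; linarith
      exact_mod_cast this) z
    (fun y hy => by
      simp only [hqe]
      exact sum_edgeProb_mul_nonpos loops hp hw0 y hy)
    (fun x => by
      simp only [hqe]
      exact half_expectedDegree_le loops hp hw0 hstar hne x)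
    hρ hρd hvar (even_two_mul k) hk0 (inv_pos.2 hℓ0)
  refine main.trans ?_
  rw [hcard, two_mul N⁻¹]
  have hNinv : N⁻¹ = Real.exp (-ℓ) := by rw [Real.exp_neg, hexp]
  refine add_le_add ?_ ?_
  · rw [hNinv, ← hexp, ← Real.exp_add, Real.exp_le_exp, hρdef, mul_inv, inv_inv]
    nlinarith [mul_le_mul_of_nonneg_left (mul_self_le_mul_self (by norm_num) hlog) hℓ0.le]
  · have h1 : ((2 * k + 1).factorial : ℝ) ≤ (5 * ℓ) ^ (2 * k) := by
      have h2 : ((2 * k + 1).factorial : ℝ) ≤ ((2 * k + 1 : ℕ) : ℝ) ^ (2 * k) := by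
        exact_mod_cast factorial_succ_le_pow (2 * k)
      refine h2.trans ?_
      gcongr
      push_cast
      linarith
    -- The threshold `14` for `ℓ` exceeds `5e`.
    have h3 : 5 * ℓ * (ρ / ℓ⁻¹) ≤ Real.exp (-1) := by
      have h4 : 5 * ℓ * (ρ / ℓ⁻¹) = 5 / ℓ := by
        rw [hρdef]; field_simp
      rw [h4, div_le_iff₀ hℓ0]
      nlinarith [Real.exp_neg_one_gt_d9]
    calc N * (2 * k + 1).factorial * (ρ / ℓ⁻¹) ^ (2 * k)
        ≤ N * (5 * ℓ) ^ (2 * k) * (ρ / ℓ⁻¹) ^ (2 * k) := by gcongr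
      _ = N * (5 * ℓ * (ρ / ℓ⁻¹)) ^ (2 * k) := by rw [mul_pow (5 * ℓ)]; ring
      _ ≤ N * Real.exp (-1) ^ (2 * k) := by gcongr
      _ ≤ N⁻¹ := by
        rw [← Real.exp_nat_mul, hNinv, ← hexp, ← Real.exp_add, Real.exp_le_exp]
        push_cast
        linarith

end Model

end WeightedRandomGraph

/-! ### Passage to the limit -/

theorem mainTheorem7
    (loops : Bool)
    (m₁ m₂ : ℕ → ℕ) (hm₁ : ∀ k, 1 ≤ m₁ k) (hm₂ : ∀ k, 1 ≤ m₂ k)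
    (hm : Tendsto (fun k => m₁ k + 2 * m₂ k) atTop atTop)
    (wmin : ℝ) (hwmin : 0 < wmin)
    (w : ∀ k, Fin (m₁ k) ⊕ Fin (m₂ k) → ℝ) (hw : ∀ k a, wmin ≤ w k a)
    (star : ∀ k, Fin (m₁ k) → Fin (m₁ k))
    (hstar : ∀ k, Function.Involutive (star k)) (hstar_ne : ∀ k i, star k i ≠ i)
    (p : ℕ → ℝ) (hp_nonneg : ∀ k, 0 ≤ p k) (hp_lt : ∀ k, p k < 1 / 2)
    (hprob : ∀ k e, WeightedRandomGraph.edgeProb loops (w k) (p k) (star k) e ≤ 1)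
    (hp : (fun k => WeightedRandomGraph.weightMax (w k) ^ 2 *
            Real.log ((m₁ k : ℝ) + 2 * (m₂ k : ℝ)) ^ 6)
          =o[atTop] (fun k => ((m₁ k : ℝ) + 2 * (m₂ k : ℝ)) * p k)) :
    ∃ ε : ℕ → ℝ, Tendsto ε atTop (𝓝 0) ∧
      Tendsto
        (fun k => WeightedRandomGraph.law loops (w k) (p k) (star k)
          {G | 1 - ε (m₁ k + 2 * m₂ k) ≤ WeightedRandomGraph.lambda G 1})
        atTop (𝓝 1) := by
  open WeightedRandomGraph in
  have hN : Tendsto (fun k => (m₁ k : ℝ) + 2 * (m₂ k : ℝ)) atTop atTop := by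
    have := tendsto_natCast_atTop_atTop (R := ℝ).comp hm
    simpa [Function.comp_def] using this
  have hlog : Tendsto (fun n : ℕ => Real.log n) atTop atTop :=
    Real.tendsto_log_atTop.comp tendsto_natCast_atTop_atTop
  refine ⟨fun n => 4 * (Real.log n)⁻¹, by simpa using hlog.inv_tendsto_atTop.const_mul 4, ?_⟩
  have hbad : ∀ᶠ k in atTop, (law loops (w k) (p k) (star k)).real
      {G | lambda G 1 < 1 - 4 * (Real.log ((m₁ k : ℝ) + 2 * m₂ k))⁻¹} ≤
        2 * ((m₁ k : ℝ) + 2 * m₂ k)⁻¹ := by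
    -- Since `weightMax ≥ wmin`, this constant gives `4 log⁶ N ≤ N p wmin²`.
    filter_upwards [hp.bound (show (0 : ℝ) < wmin ^ 4 / 4 by positivity),
      (Real.tendsto_log_atTop.comp hN).eventually_ge_atTop 14] with k hk hl
    refine measureReal_law_lambda_one_lt_le loops hwmin (hw k) (hstar k) (hstar_ne k) (hp_nonneg k)
      (hprob k) hl ?_
    have hmax : wmin ≤ weightMax (w k) :=
      (hw k (Sum.inl ⟨0, hm₁ k⟩)).trans (le_ciSup (Set.finite_range (w k)).bddAbove _)
    have hpk := hp_nonneg k
    rw [Real.norm_of_nonneg (by positivity), Real.norm_of_nonneg (by positivity)] at hk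
    have h1 : wmin ^ 2 * Real.log ((m₁ k : ℝ) + 2 * m₂ k) ^ 6 ≤
        wmin ^ 4 / 4 * (((m₁ k : ℝ) + 2 * m₂ k) * p k) := by
      refine le_trans ?_ hk
      gcongr
    have h2 : 0 < wmin ^ 2 := by positivity
    refine le_of_mul_le_mul_left ?_ h2
    linarith
  have hreal : Tendsto (fun k => (law loops (w k) (p k) (star k)).real
      {G | 1 - 4 * (Real.log ((m₁ k + 2 * m₂ k : ℕ) : ℝ))⁻¹ ≤ lambda G 1}) atTop (𝓝 1) := by
    have hlow : Tendsto (fun k => 1 - 2 * ((m₁ k : ℝ) + 2 * m₂ k)⁻¹) atTop (𝓝 1) := by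
      simpa using (hN.inv_tendsto_atTop.const_mul 2).const_sub 1
    have : ∀ k, IsProbabilityMeasure (law loops (w k) (p k) (star k)) := fun k => by
      unfold law; infer_instance
    refine tendsto_of_tendsto_of_tendsto_of_le_of_le' hlow tendsto_const_nhds ?_
      (Eventually.of_forall fun k => measureReal_le_one)
    filter_upwards [hbad] with k hk
    have hcompl : {G | 1 - 4 * (Real.log ((m₁ k + 2 * m₂ k : ℕ) : ℝ))⁻¹ ≤ lambda G 1} =
        {G : Sym2 (Vertex (m₁ k) (m₂ k)) → Bool |
          lambda G 1 < 1 - 4 * (Real.log ((m₁ k : ℝ) + 2 * m₂ k))⁻¹}ᶜ := by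
      ext G
      simp
    rw [hcompl, probReal_compl_eq_one_sub (Set.toFinite _).measurableSet]
    linarith
  have := ENNReal.tendsto_ofReal hreal
  rw [ENNReal.ofReal_one] at this
  refine this.congr fun k => ?_
  have : IsProbabilityMeasure (law loops (w k) (p k) (star k)) := by unfold law; infer_instance
  exact ofReal_measureReal
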